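/- Let $\{s_{m,n}\}_{m,n\in\mathbb{Z}_+}$ be a sequence of complex numbers, where $\mathbb{Z}_+=\{0,1,2,\dots\}$, and let $$\Omega=\{(m,k,l;n,r,t):\ m,n\in\mathbb{Z}_+,\ k,l,r,t\in\mathbb{Z}\}.$$ The two-dimensional moment problem for $\{s_{m,n}\}$ has a solution, i.e. there exists a non-negative Borel measure $\mu$ on $\mathbb{R}^2$ such that, for all $m,n\in\mathbb{Z}_+$, the function $x_1^m x_2^n$ is $\mu$-integrable and $$\int_{\mathbb{R}^2} x_1^m x_2^n\,d\mu=s_{m,n},$$ if and only if there exists a sequence of complex numbers $\{u_{m,k,l;n,r,t}\}_{(m,k,l;n,r,t)\in\Omega}$ satisfying the following three conditions. (i) For all complex coefficients $\alpha_{m,k,l;n,r,t}$, $(m,k,l;n,r,t)\in\Omega$, all but finitely many of which are zero, $$\sum_{(m,k,l;n,r,t),\,(m',k',l';n',r',t')\in\Omega}\alpha_{m,k,l;n,r,t}\,\overline{\alpha_{m',k',l';n',r',t'}}\;u_{m+m',\,k+l',\,l+k';\,n+n',\,r+t',\,t+r'}\ \ge 0$$ (that is, the sum is real and non-negative). (ii)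 For all $(m,k,l;n,r,t),(a,b,c;d,e,f)\in\Omega$, $$u_{m+1+a,k+c,l+b;n+d,r+f,t+e}+i\,u_{m+a,k+c,l+b;n+d,r+f,t+e}=u_{m+a,k+1+c,l+b;n+d,r+f,t+e},$$ $$u_{m+1+a,k+c,l+b;n+d,r+f,t+e}-i\,u_{m+a,k+c,l+b;n+d,r+f,t+e}=u_{m+a,k+c,l+1+b;n+d,r+f,t+e},$$ $$u_{m+a,k+c,l+b;n+1+d,r+f,t+e}+i\,u_{m+a,k+c,l+b;n+d,r+f,t+e}=u_{m+a,k+c,l+b;n+d,r+1+f,t+e},$$ $$u_{m+a,k+c,l+b;n+1+d,r+f,t+e}-i\,u_{m+a,k+c,l+b;n+d,r+f,t+e}=u_{m+a,k+c,l+b;n+d,r+f,t+1+e}.$$ (iii) $u_{m,0,0;n,0,0}=s_{m,n}$ for all $m,n\in\mathbb{Z}_+$. -/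

import Mathlib

open MeasureTheory

/-- The index set `Ω` of all sextuples `(m, k, l; n, r, t)` with `m, n ∈ ℤ₊` and
`k, l, r, t ∈ ℤ`. -/
@[ext]
structure Omega where
  m : ℕ
  k : ℤ
  l : ℤ
  n : ℕ
  r : ℤ
  t : ℤ

/-- `μ` is a solution of the two-dimensional moment problem with the prescribed moments `s`:
all the monomials `x₁ ^ m * x₂ ^ n` are `μ`-integrable and their integrals are `s m n`. -/
def SolvesMomentProblem (s : ℕ → ℕ → ℂ) (μ : Measure (ℝ × ℝ)) : Prop :=
  ∀ m n : ℕ,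
    Integrable (fun x : ℝ × ℝ => (x.1 : ℂ) ^ m * (x.2 : ℂ) ^ n) μ ∧
      ∫ x : ℝ × ℝ, (x.1 : ℂ) ^ m * (x.2 : ℂ) ^ n ∂μ = s m n

open scoped ComplexOrder in
/-- Positivity of the sequence `u`: for every finitely supported family of complex coefficients
`α` on `Ω`, the sum over all `p, q ∈ Ω` of
`α_p * conj α_q * u_{m+m', k+l', l+k'; n+n', r+t', t+r'}`, where `p = (m, k, l; n, r, t)` and
`q = (m', k', l'; n', r', t')`, is a non-negative real number
(this is the meaning of `0 ≤ z` for a complex `z`). -/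
def ExtPositive (u : Omega → ℂ) : Prop :=
  ∀ α : Omega →₀ ℂ,
    0 ≤ ∑ p ∈ α.support, ∑ q ∈ α.support,
      α p * (starRingEnd ℂ) (α q) *
        u ⟨p.m + q.m, p.k + q.l, p.l + q.k, p.n + q.n, p.r + q.t, p.t + q.r⟩

/-- Multiplication by `x₁` plus `i` times the sequence raises the exponent of `x₁ + i`. -/
def ExtRelAPlus (u : Omega → ℂ) : Prop :=
  ∀ (m : ℕ) (k l : ℤ) (n : ℕ) (r t : ℤ) (a : ℕ) (b c : ℤ) (d : ℕ) (e f : ℤ),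
    u ⟨m + 1 + a, k + c, l + b, n + d, r + f, t + e⟩
        + Complex.I * u ⟨m + a, k + c, l + b, n + d, r + f, t + e⟩
      = u ⟨m + a, k + 1 + c, l + b, n + d, r + f, t + e⟩

/-- Multiplication by `x₁` minus `i` times the sequence raises the exponent of `x₁ - i`. -/
def ExtRelAMinus (u : Omega → ℂ) : Prop :=
  ∀ (m : ℕ) (k l : ℤ) (n : ℕ) (r t : ℤ) (a : ℕ) (b c : ℤ) (d : ℕ) (e f : ℤ),
    u ⟨m + 1 + a, k + c, l + b, n + d, r + f, t + e⟩
        - Complex.I * u ⟨m + a, k + c, l + b, n + d, r + f, t + e⟩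
      = u ⟨m + a, k + c, l + 1 + b, n + d, r + f, t + e⟩

/-- Multiplication by `x₂` plus `i` times the sequence raises the exponent of `x₂ + i`. -/
def ExtRelBPlus (u : Omega → ℂ) : Prop :=
  ∀ (m : ℕ) (k l : ℤ) (n : ℕ) (r t : ℤ) (a : ℕ) (b c : ℤ) (d : ℕ) (e f : ℤ),
    u ⟨m + a, k + c, l + b, n + 1 + d, r + f, t + e⟩
        + Complex.I * u ⟨m + a, k + c, l + b, n + d, r + f, t + e⟩
      = u ⟨m + a, k + c, l + b, n + d, r + 1 + f, t + e⟩

/-- Multiplication by `x₂` minus `i` times the sequence raises the exponent of `x₂ - i`. -/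
def ExtRelBMinus (u : Omega → ℂ) : Prop :=
  ∀ (m : ℕ) (k l : ℤ) (n : ℕ) (r t : ℤ) (a : ℕ) (b c : ℤ) (d : ℕ) (e f : ℤ),
    u ⟨m + a, k + c, l + b, n + 1 + d, r + f, t + e⟩
        - Complex.I * u ⟨m + a, k + c, l + b, n + d, r + f, t + e⟩
      = u ⟨m + a, k + c, l + b, n + d, r + f, t + 1 + e⟩

/-! If `μ` solves the moment problem, integrate the functions x^m (x+i)^k (x-i)^l y^n (y+i)^r
(y-i)^t. They are dominated by powers of 1+x² and 1+y², the relations hold pointwise, and the double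
sum in `ExtPositive` is the integral of a squared modulus.

For the converse, Haviland's theorem reduces everything to showing that the functional given by `s`
is non-negative on a polynomial q ≥ 0. Such a q need not be a sum of squares; the extra indices of
`u` make up for this. The identities x = ((x+i)+(x-i))/2 and 1 = ((x+i)-(x-i))/(2i), and the same in
y, follow from the relations and turn q into ((x²+1)(y²+1))^N times a trigonometric polynomial g in
the Cayley transforms of x and y. The reduction is made on formal combinations, so the same g serves
for `u` and for point evaluations (`exists_trigonometric_representation`). Evaluations give g ≥ 0,
while positivity of `u` makes its values along these indices a positive definite function on ℤ².
Such a function pairs non-negatively with g: averaging over a finite grid gives a Schur product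
inequality, and Fejér means pass to the limit (`IsPosDefOnIntProd.sum_nonneg`). -/

/-! ### Haviland's theorem -/

section Haviland

open Filter Topology MvPolynomial CompactlySupported

variable {σ : Type*}

/-- A linear functional on real polynomials that is non-negative on polynomials non-negative on
`σ → ℝ` can be complemented by a linear functional on compactly supported functions, so that both
together are monotone. -/
theorem exists_linearMap_compactlySupported_monotone [Finite σ]
    (L : MvPolynomial σ ℝ →ₗ[ℝ] ℝ)
    (hL : ∀ q, (∀ x, 0 ≤ eval x q) → 0 ≤ L q) :
    ∃ Λ : C_c(σ → ℝ, ℝ) →ₗ[ℝ] ℝ,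
      (∀ (φ : C_c(σ → ℝ, ℝ)) q, (∀ x, φ x ≤ eval x q) → Λ φ ≤ L q) ∧
      (∀ (φ : C_c(σ → ℝ, ℝ)) q, (∀ x, eval x q ≤ φ x) → L q ≤ Λ φ) := by
  -- The pair (φ, q) stands for the function φ + q; `L` is extended from the pairs (0, q) by the M.
  -- Riesz theorem.
  let C : PointedCone ℝ (C_c(σ → ℝ, ℝ) × MvPolynomial σ ℝ) :=
    { carrier := {p | ∀ x, 0 ≤ p.1 x + eval x p.2}
      add_mem' := by
        intro a b ha hb x
        have := add_nonneg (ha x) (hb x)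
        simp only [Prod.fst_add, Prod.snd_add, map_add, CompactlySupportedContinuousMap.add_apply]
        linarith
      zero_mem' := by intro x; simp
      smul_mem' := by
        intro c a ha x
        have := mul_nonneg c.2 (ha x)
        have e : (c • a).2 = (c : ℝ) • a.2 := rfl
        have e1 : (c • a).1 x = (c : ℝ) * a.1 x := rfl
        rw [e, e1, smul_eval]
        rw [mul_add] at this
        exact this }
  let D : Submodule ℝ (C_c(σ → ℝ, ℝ) × MvPolynomial σ ℝ) :=
    LinearMap.ker (LinearMap.fst ℝ (C_c(σ → ℝ, ℝ)) (MvPolynomial σ ℝ))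
  let f : (C_c(σ → ℝ, ℝ) × MvPolynomial σ ℝ) →ₗ.[ℝ] ℝ :=
    (L ∘ₗ LinearMap.snd ℝ (C_c(σ → ℝ, ℝ)) (MvPolynomial σ ℝ)).toPMap D
  obtain ⟨g, hg, hgpos⟩ := riesz_extension C f
    (by
      rintro ⟨⟨φ, q⟩, hD⟩ hx
      have h0 : φ = 0 := hD
      subst h0
      refine hL q fun x => ?_
      have := hx x
      simpa using this)
    (by
      rintro ⟨φ, q⟩
      obtain ⟨c, hc⟩ := (φ.hasCompactSupport.exists_bound_of_continuous φ.continuous)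
      -- Adding this element leaves φ + c, which is non-negative since |φ| ≤ c.
      refine ⟨⟨(0, MvPolynomial.C c - q), LinearMap.mem_ker.mpr rfl⟩, fun x => ?_⟩
      have := neg_le_of_abs_le (hc x)
      simp only [Prod.fst_add, Prod.snd_add, zero_add, sub_add_cancel, eval_C]
      linarith)
  have hgL : ∀ q, g (0, q) = L q := fun q => hg ⟨(0, q), LinearMap.mem_ker.mpr rfl⟩
  refine ⟨g ∘ₗ LinearMap.inl ℝ _ _, fun φ q h => ?_, fun φ q h => ?_⟩
  · have h1 := hgpos (-φ, q) (fun x => by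
      have := h x
      change 0 ≤ -φ x + eval x q
      linarith)
    have h2 : ((-φ, q) : C_c(σ → ℝ, ℝ) × MvPolynomial σ ℝ) = (0, q) - (φ, 0) := by simp
    rw [h2, map_sub, hgL] at h1
    simpa using h1
  · have h1 := hgpos (φ, -q) (fun x => by
      have := h x
      change 0 ≤ φ x + eval x (-q)
      rw [map_neg]
      linarith)
    have h2 : ((φ, -q) : C_c(σ → ℝ, ℝ) × MvPolynomial σ ℝ) = (φ, 0) - (0, q) := by simp
    rw [h2, map_sub, hgL] at h1
    simpa using h1

/-- Every polynomial is a difference of two polynomials that are non-negative everywhere. -/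
theorem exists_sub_eq_of_eval_nonneg (q : MvPolynomial σ ℝ) :
    ∃ a b : MvPolynomial σ ℝ, (∀ x, 0 ≤ eval x a) ∧ (∀ x, 0 ≤ eval x b) ∧ a - b = q :=
  -- Note that 2(1 + q + q²) = (q + 1)² + q² + 1.
  ⟨1 + q + q ^ 2, 1 + q ^ 2,
    fun x => by
      simp only [map_add, map_one, map_pow]
      nlinarith [sq_nonneg (eval x q + 1), sq_nonneg (eval x q)],
    fun x => by
      simp only [map_add, map_one, map_pow]
      positivity,
    by ring⟩

variable [Fintype σ]

/-- A continuous cutoff equal to `1` where `∑ i, x i ^ 2 ≤ R` and to `0` where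
`2 * R ≤ ∑ i, x i ^ 2`. -/
noncomputable def radialCutoff (R : ℝ) (x : σ → ℝ) : ℝ :=
  max 0 (min 1 (2 - (∑ i, x i ^ 2) / R))

theorem continuous_radialCutoff (R : ℝ) : Continuous (radialCutoff (σ := σ) R) := by
  unfold radialCutoff
  fun_prop

theorem radialCutoff_nonneg (R : ℝ) (x : σ → ℝ) : 0 ≤ radialCutoff R x := le_max_left _ _

theorem radialCutoff_le_one (R : ℝ) (x : σ → ℝ) : radialCutoff R x ≤ 1 :=
  max_le zero_le_one (min_le_left _ _)

theorem one_sub_radialCutoff_le {R : ℝ} (hR : 0 < R) (x : σ → ℝ) :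
    1 - radialCutoff R x ≤ (∑ i, x i ^ 2) / R := by
  have h0 : 0 ≤ (∑ i, x i ^ 2) / R := by positivity
  unfold radialCutoff
  rcases le_total ((∑ i, x i ^ 2) / R) 1 with h | h
  · rw [min_eq_left (by linarith)]
    simpa using h0
  · have := le_max_left 0 (min 1 (2 - (∑ i, x i ^ 2) / R))
    linarith

theorem hasCompactSupport_radialCutoff {R : ℝ} (hR : 0 < R) :
    HasCompactSupport (radialCutoff (σ := σ) R) := by
  refine HasCompactSupport.intro (isCompact_closedBall 0 (2 * R + 1)) fun x hx => ?_
  rw [mem_closedBall_zero_iff, pi_norm_le_iff_of_nonneg (by positivity)] at hx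
  push Not at hx
  obtain ⟨i, hi⟩ := hx
  have h1 : x i ^ 2 ≤ ∑ i, x i ^ 2 :=
    Finset.single_le_sum (f := fun i => x i ^ 2) (fun i _ => sq_nonneg _) (Finset.mem_univ i)
  have h2 : 2 * R ≤ x i ^ 2 := by
    rw [Real.norm_eq_abs] at hi
    rw [← sq_abs]
    nlinarith
  have h3 : 2 ≤ (∑ i, x i ^ 2) / R := by
    rw [le_div_iff₀ hR]
    linarith
  unfold radialCutoff
  rw [max_eq_left]
  exact (min_le_right _ _).trans (by linarith)

theorem tendsto_radialCutoff (x : σ → ℝ) :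
    Tendsto (fun n : ℕ => radialCutoff (n + 1 : ℝ) x) atTop (𝓝 1) := by
  have h : Tendsto (fun n : ℕ => 1 - (∑ i, x i ^ 2) / (n + 1 : ℝ)) atTop (𝓝 (1 - 0)) := by
    refine tendsto_const_nhds.sub ?_
    have := (tendsto_one_div_add_atTop_nhds_zero_nat (𝕜 := ℝ)).const_mul (∑ i, x i ^ 2)
    simpa [div_eq_mul_inv] using this
  rw [sub_zero] at h
  refine tendsto_of_tendsto_of_tendsto_of_le_of_le h tendsto_const_nhds (fun n => ?_)
    (fun n => radialCutoff_le_one _ x)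
  have := one_sub_radialCutoff_le (R := (n + 1 : ℝ)) (by positivity) x
  simp only
  linarith

/-- The product of a cutoff and a polynomial, as a compactly supported function. -/
noncomputable def cutoffPolynomial (n : ℕ) (q : MvPolynomial σ ℝ) : C_c(σ → ℝ, ℝ) where
  toFun x := radialCutoff (n + 1 : ℝ) x * eval x q
  continuous_toFun := (continuous_radialCutoff _).mul (MvPolynomial.continuous_eval q)
  hasCompactSupport' := (hasCompactSupport_radialCutoff (by positivity)).mul_right

theorem cutoffPolynomial_apply (n : ℕ) (q : MvPolynomial σ ℝ) (x : σ → ℝ) :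
    cutoffPolynomial n q x = radialCutoff (n + 1 : ℝ) x * eval x q := rfl

/-- Cutoffs of q increase to it only up to an error q·|x|²/(n+1), which is again a polynomial.
Monotonicity against polynomials therefore squeezes `Λ` of the cutoffs to `L q`, so no mass escapes
to infinity. -/
theorem integrable_and_integral_eq_of_nonneg
    {L : MvPolynomial σ ℝ →ₗ[ℝ] ℝ} {Λ : C_c(σ → ℝ, ℝ) →ₗ[ℝ] ℝ} {μ : Measure (σ → ℝ)}
    (h₁ : ∀ (φ : C_c(σ → ℝ, ℝ)) q, (∀ x, φ x ≤ eval x q) → Λ φ ≤ L q)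
    (h₂ : ∀ (φ : C_c(σ → ℝ, ℝ)) q, (∀ x, eval x q ≤ φ x) → L q ≤ Λ φ)
    (hμ : ∀ φ : C_c(σ → ℝ, ℝ), Integrable φ μ ∧ ∫ x, φ x ∂μ = Λ φ)
    {q : MvPolynomial σ ℝ} (hq : ∀ x, 0 ≤ eval x q) :
    Integrable (fun x => eval x q) μ ∧ ∫ x, eval x q ∂μ = L q := by
  have hcont : Continuous fun x => eval x q := MvPolynomial.continuous_eval q
  have hle : ∀ n x, cutoffPolynomial n q x ≤ eval x q := fun n x => by
    rw [cutoffPolynomial_apply]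
    exact mul_le_of_le_one_left (hq x) (radialCutoff_le_one _ x)
  have hnn : ∀ n x, 0 ≤ cutoffPolynomial n q x := fun n x =>
    mul_nonneg (radialCutoff_nonneg _ x) (hq x)
  have hpt : ∀ x, Tendsto (fun n => cutoffPolynomial n q x) atTop (𝓝 (eval x q)) := fun x => by
    simpa only [cutoffPolynomial_apply, one_mul] using
      (tendsto_radialCutoff x).mul_const (eval x q)
  have hup : ∀ n, Λ (cutoffPolynomial n q) ≤ L q := fun n => h₁ _ _ (hle n)
  have hlow : ∀ n : ℕ, L q - L (q * ∑ i, X i ^ 2) * (1 / ((n : ℝ) + 1)) ≤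
      Λ (cutoffPolynomial n q) := fun n => by
    have h := h₂ (cutoffPolynomial n q) (q - (1 / ((n : ℝ) + 1)) • (q * ∑ i, X i ^ 2))
      (fun x => by
        rw [cutoffPolynomial_apply, map_sub, smul_eval, map_mul, map_sum]
        simp only [map_pow, eval_X]
        have h3 := one_sub_radialCutoff_le (R := (n + 1 : ℝ)) (by positivity) x
        have h4 := mul_le_mul_of_nonneg_right h3 (hq x)
        rw [div_eq_mul_one_div] at h4
        linarith)
    rw [map_sub, map_smul, smul_eq_mul] at h
    linarith
  have hlim : Tendsto (fun n => Λ (cutoffPolynomial n q)) atTop (𝓝 (L q)) := by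
    refine tendsto_of_tendsto_of_tendsto_of_le_of_le ?_ tendsto_const_nhds hlow hup
    simpa using tendsto_const_nhds.sub
      ((tendsto_one_div_add_atTop_nhds_zero_nat (𝕜 := ℝ)).const_mul (L (q * ∑ i, X i ^ 2)))
  have hint : Integrable (fun x => eval x q) μ := by
    -- Fatou's lemma, with the integrals of the cutoffs bounded by `L q`.
    refine ⟨hcont.aestronglyMeasurable, ?_⟩
    rw [hasFiniteIntegral_iff_ofReal (Eventually.of_forall hq)]
    refine lt_of_le_of_lt ?_ (ENNReal.ofReal_lt_top (r := L q))
    have h : ∀ x, ENNReal.ofReal (eval x q) =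
        liminf (fun n => ENNReal.ofReal (cutoffPolynomial n q x)) atTop := fun x =>
      ((ENNReal.continuous_ofReal.tendsto _).comp (hpt x)).liminf_eq.symm
    simp_rw [h]
    refine (lintegral_liminf_le fun n => ?_).trans ?_
    · exact ENNReal.measurable_ofReal.comp (cutoffPolynomial n q).continuous.measurable
    · refine liminf_le_of_le (by isBoundedDefault) fun b hb => ?_
      obtain ⟨n, hn⟩ := hb.exists
      refine hn.trans ?_
      rw [← ofReal_integral_eq_lintegral_ofReal (hμ _).1 (Eventually.of_forall (hnn n)),
        (hμ _).2]
      exact ENNReal.ofReal_le_ofReal (hup n)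
  refine ⟨hint, ?_⟩
  have hdom : Tendsto (fun n => ∫ x, cutoffPolynomial n q x ∂μ) atTop (𝓝 (∫ x, eval x q ∂μ)) :=
    tendsto_integral_of_dominated_convergence (fun x => eval x q)
      (fun n => (cutoffPolynomial n q).continuous.aestronglyMeasurable) hint
      (fun n => Eventually.of_forall fun x => by
        rw [Real.norm_of_nonneg (hnn n x)]
        exact hle n x)
      (Eventually.of_forall hpt)
  simp_rw [fun n => (hμ (cutoffPolynomial n q)).2] at hdom
  exact tendsto_nhds_unique hdom hlim

/-- **Haviland's theorem**: a linear functional on real polynomials that is non-negative on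
polynomials non-negative on `σ → ℝ` is integration against a measure. -/
theorem exists_measure_of_nonneg_of_eval_nonneg (L : MvPolynomial σ ℝ →ₗ[ℝ] ℝ)
    (hL : ∀ q, (∀ x, 0 ≤ eval x q) → 0 ≤ L q) :
    ∃ μ : Measure (σ → ℝ), ∀ q,
      Integrable (fun x => eval x q) μ ∧ ∫ x, eval x q ∂μ = L q := by
  obtain ⟨Λ, h₁, h₂⟩ := exists_linearMap_compactlySupported_monotone L hL
  let Λ' : C_c(σ → ℝ, ℝ) →ₚ[ℝ] ℝ := PositiveLinearMap.mk₀ Λ fun φ hφ => by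
    have := h₂ φ 0 (fun x => by simpa using hφ x)
    simpa using this
  have hμ : ∀ φ : C_c(σ → ℝ, ℝ), Integrable φ (RealRMK.rieszMeasure Λ') ∧
      ∫ x, φ x ∂(RealRMK.rieszMeasure Λ') = Λ φ := fun φ =>
    ⟨φ.continuous.integrable_of_hasCompactSupport φ.hasCompactSupport,
      RealRMK.integral_rieszMeasure Λ' φ⟩
  refine ⟨RealRMK.rieszMeasure Λ', fun q => ?_⟩
  obtain ⟨a, b, ha, hb, rfl⟩ := exists_sub_eq_of_eval_nonneg q
  obtain ⟨ia, ea⟩ := integrable_and_integral_eq_of_nonneg h₁ h₂ hμ ha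
  obtain ⟨ib, eb⟩ := integrable_and_integral_eq_of_nonneg h₁ h₂ hμ hb
  simp only [map_sub]
  exact ⟨ia.sub ib, by rw [integral_sub ia ib, ea, eb]⟩

end Haviland

/-! ### Positive definite functions on ℤ² and non-negative trigonometric polynomials -/

section TrigonometricPositivity

open Filter Topology Complex ComplexConjugate
open scoped ComplexOrder

theorem ofReal_add_I_ne_zero (x : ℝ) : (x : ℂ) + I ≠ 0 := fun h => by
  simpa using congrArg Complex.im h

theorem ofReal_sub_I_ne_zero (x : ℝ) : (x : ℂ) - I ≠ 0 := fun h => by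
  simpa using congrArg Complex.im h

/-- Every point of the unit circle other than `1` is the image of a real number under the Cayley
transform. -/
theorem exists_real_cayley_eq {z : ℂ} (hz : ‖z‖ = 1) (h1 : z ≠ 1) :
    ∃ x : ℝ, ((x : ℂ) + I) / ((x : ℂ) - I) = z := by
  have h0 : z ≠ 0 := fun h => by simp [h] at hz
  have hs : z - 1 ≠ 0 := sub_ne_zero.mpr h1
  have hs' : 1 - z ≠ 0 := sub_ne_zero.mpr h1.symm
  have hconj : conj z = z⁻¹ := by rw [Complex.inv_def, Complex.normSq_eq_norm_sq, hz]; simp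
  -- This is the inverse Cayley transform of z.
  have hreal : conj (I * (z + 1) / (z - 1)) = I * (z + 1) / (z - 1) := by
    have hs'' : z⁻¹ - 1 ≠ 0 := by
      rw [sub_ne_zero]
      simpa using h1
    simp only [map_div₀, map_mul, map_add, map_sub, map_one, conj_I, hconj]
    rw [div_eq_div_iff hs'' hs]
    field_simp
    ring
  obtain ⟨x, hx⟩ := Complex.conj_eq_iff_real.mp hreal
  refine ⟨x, ?_⟩
  have hx' : (x : ℂ) - I ≠ 0 := ofReal_sub_I_ne_zero x
  rw [div_eq_iff hx', ← hx]
  field_simp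
  ring

/-- The `M`-th roots of `-1` are Cayley transforms of real numbers, and their power sums of
exponent `d` with `0 < |d| < M` vanish. -/
theorem exists_cayley_orthogonal {M : ℕ} (hM : 0 < M) :
    ∃ x : ℕ → ℝ, ∀ d : ℤ, |d| < M →
      ∑ a ∈ Finset.range M, (((x a : ℂ) + I) / ((x a : ℂ) - I)) ^ d = if d = 0 then (M : ℂ) else 0 := by
  have hM0 : (M : ℂ) ≠ 0 := by exact_mod_cast hM.ne'
  set ζ : ℂ := exp (2 * Real.pi * I / M) with hζ
  set ω : ℂ := exp (Real.pi * I / M) with hω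
  have hprim : IsPrimitiveRoot ζ M := Complex.isPrimitiveRoot_exp M hM.ne'
  have hωM : ω ^ M = -1 := by
    rw [hω, ← Complex.exp_nat_mul, mul_div_cancel₀ _ hM0, Complex.exp_pi_mul_I]
  have hζ0 : ζ ≠ 0 := Complex.exp_ne_zero _
  have hω0 : ω ≠ 0 := Complex.exp_ne_zero _
  -- Roots of -1 rather than of 1, because the Cayley transform of a real number never equals 1.
  have hpow : ∀ a : ℕ, (ω * ζ ^ a) ^ M = -1 := fun a => by
    rw [mul_pow, hωM, ← pow_mul, mul_comm a, pow_mul, hprim.pow_eq_one, one_pow, mul_one]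
  have hx : ∀ a : ℕ, ∃ x : ℝ, ((x : ℂ) + I) / ((x : ℂ) - I) = ω * ζ ^ a := fun a => by
    refine exists_real_cayley_eq ?_ fun h => ?_
    · have := congrArg norm (hpow a)
      rw [norm_pow, norm_neg, norm_one] at this
      exact (pow_eq_one_iff_of_nonneg (norm_nonneg _) hM.ne').mp this
    · have := hpow a
      rw [h, one_pow] at this
      norm_num at this
  choose x hx using hx
  refine ⟨x, fun d hd => ?_⟩
  simp_rw [hx]
  split_ifs with h0
  · simp [h0]
  · have h1 : ζ ^ d ≠ 1 := fun h => by
      have := (hprim.zpow_eq_one_iff_dvd d).mp h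
      exact h0 (Int.eq_zero_of_abs_lt_dvd this hd)
    have h2 : ∀ a : ℕ, (ω * ζ ^ a) ^ d = ω ^ d * (ζ ^ d) ^ a := fun a => by
      rw [mul_zpow, ← zpow_natCast, ← zpow_natCast, ← zpow_mul, ← zpow_mul, mul_comm d]
    simp_rw [h2]
    rw [← Finset.mul_sum, geom_sum_eq h1, ← zpow_natCast, ← zpow_mul, mul_comm d, zpow_mul,
      zpow_natCast, hprim.pow_eq_one, one_zpow]
    simp

/-- The character `d` of the torus evaluated at the Cayley transforms of `x` and `y`. -/
noncomputable def cayleyCharacter (x y : ℝ) (d : ℤ × ℤ) : ℂ :=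
  (((x : ℂ) + I) / ((x : ℂ) - I)) ^ d.1 * (((y : ℂ) + I) / ((y : ℂ) - I)) ^ d.2

theorem cayleyCharacter_add (x y : ℝ) (d e : ℤ × ℤ) :
    cayleyCharacter x y (d + e) = cayleyCharacter x y d * cayleyCharacter x y e := by
  have h : ∀ x : ℝ, ((x : ℂ) + I) / ((x : ℂ) - I) ≠ 0 := fun x =>
    div_ne_zero (ofReal_add_I_ne_zero x) (ofReal_sub_I_ne_zero x)
  simp only [cayleyCharacter, Prod.fst_add, Prod.snd_add, zpow_add₀ (h x), zpow_add₀ (h y)]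
  ring

theorem conj_cayleyCharacter (x y : ℝ) (d : ℤ × ℤ) :
    conj (cayleyCharacter x y d) = cayleyCharacter x y (-d) := by
  have h : ∀ x : ℝ, conj (((x : ℂ) + I) / ((x : ℂ) - I)) = (((x : ℂ) + I) / ((x : ℂ) - I))⁻¹ :=
    fun x => by simp [← sub_eq_add_neg]
  simp only [cayleyCharacter, map_mul, map_zpow₀, h, Prod.fst_neg, Prod.snd_neg, zpow_neg, inv_zpow]

/-- Positive definiteness of a function on `ℤ × ℤ`. -/
def IsPosDefOnIntProd (c : ℤ × ℤ → ℂ) : Prop :=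
  ∀ β : ℤ × ℤ →₀ ℂ, 0 ≤ β.sum fun p a => β.sum fun q b => a * conj b * c (p - q)

theorem IsPosDefOnIntProd.sum_finset_nonneg {c : ℤ × ℤ → ℂ} (hc : IsPosDefOnIntProd c)
    (B : Finset (ℤ × ℤ)) (β : ℤ × ℤ → ℂ) :
    0 ≤ ∑ p ∈ B, ∑ q ∈ B, β p * conj (β q) * c (p - q) := by
  classical
  have h := hc (Finsupp.onFinset B (fun p => if p ∈ B then β p else 0) (by
    intro p hp
    by_contra h
    simp [h] at hp))
  rw [Finsupp.onFinset_sum _ (by simp)] at h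
  refine h.trans_eq (Finset.sum_congr rfl fun p hp => ?_)
  rw [Finsupp.onFinset_sum _ (by simp)]
  refine Finset.sum_congr rfl fun q hq => ?_
  simp [hp, hq]

/-- Provides a grid fine enough that discrete orthogonality has no aliasing among the frequencies
involved. -/
theorem exists_abs_sub_lt (S B : Finset (ℤ × ℤ)) :
    ∃ M : ℕ, 0 < M ∧ ∀ d ∈ S, ∀ p ∈ B, ∀ q ∈ B,
      |(d - (p - q)).1| < M ∧ |(d - (p - q)).2| < M := by
  let F : (ℤ × ℤ) × (ℤ × ℤ) × (ℤ × ℤ) → ℕ := fun e =>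
    (e.1 - (e.2.1 - e.2.2)).1.natAbs + (e.1 - (e.2.1 - e.2.2)).2.natAbs
  refine ⟨(S ×ˢ B ×ˢ B).sup F + 1, Nat.succ_pos _, fun d hd p hp q hq => ?_⟩
  have h : F (d, p, q) ≤ (S ×ˢ B ×ˢ B).sup F :=
    Finset.le_sup (f := F) (by simp [hd, hp, hq])
  have h' : (d - (p - q)).1.natAbs + (d - (p - q)).2.natAbs < (S ×ˢ B ×ˢ B).sup F + 1 :=
    Nat.lt_succ_of_le h
  rw [Int.abs_eq_natAbs, Int.abs_eq_natAbs]
  omega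

/-- Schur product of a positive definite function with the Fourier coefficients of a non-negative
trigonometric polynomial. -/
theorem IsPosDefOnIntProd.sum_mul_nonneg {c : ℤ × ℤ → ℂ} (hc : IsPosDefOnIntProd c)
    {g : ℤ × ℤ →₀ ℂ} (hg : ∀ x y : ℝ, 0 ≤ g.sum fun d a => a * cayleyCharacter x y d)
    (B : Finset (ℤ × ℤ)) :
    0 ≤ ∑ p ∈ B, ∑ q ∈ B, g (p - q) * c (p - q) := by
  obtain ⟨M, hM, hlt⟩ := exists_abs_sub_lt g.support B
  obtain ⟨x, hx⟩ := exists_cayley_orthogonal hM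
  have hM0 : (M : ℂ) ≠ 0 := by exact_mod_cast hM.ne'
  have hMpos : (0 : ℂ) ≤ ((M : ℂ) ^ 2)⁻¹ := by
    simp
  -- At each grid point a value of g multiplies a positive definite form with character
  -- coefficients; the average over the grid extracts the coefficient `g (p - q)`.
  have hpos : 0 ≤ ((M : ℂ) ^ 2)⁻¹ * ∑ a ∈ Finset.range M, ∑ b ∈ Finset.range M,
      (g.sum fun d e => e * cayleyCharacter (x a) (x b) d) *
        ∑ p ∈ B, ∑ q ∈ B, cayleyCharacter (x a) (x b) (-p) *
          conj (cayleyCharacter (x a) (x b) (-q)) * c (p - q) :=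
    mul_nonneg hMpos (Finset.sum_nonneg fun a _ => Finset.sum_nonneg fun b _ =>
      mul_nonneg (hg _ _) (hc.sum_finset_nonneg B fun p => cayleyCharacter (x a) (x b) (-p)))
  refine hpos.trans_eq ?_
  have hinner : ∀ p ∈ B, ∀ q ∈ B, ∑ a ∈ Finset.range M, ∑ b ∈ Finset.range M,
      (g.sum fun d e => e * cayleyCharacter (x a) (x b) d) *
        (cayleyCharacter (x a) (x b) (-p) *
          conj (cayleyCharacter (x a) (x b) (-q)) * c (p - q)) =
      (M : ℂ) ^ 2 * (g (p - q) * c (p - q)) := fun p hp q hq => by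
    have h1 : ∀ a b, (g.sum fun d e => e * cayleyCharacter (x a) (x b) d) *
        (cayleyCharacter (x a) (x b) (-p) *
          conj (cayleyCharacter (x a) (x b) (-q)) * c (p - q)) =
        ∑ d ∈ g.support, g d * cayleyCharacter (x a) (x b) (d - (p - q)) * c (p - q) := by
      intro a b
      rw [Finsupp.sum, Finset.sum_mul]
      refine Finset.sum_congr rfl fun d _ => ?_
      rw [conj_cayleyCharacter, neg_neg, show d - (p - q) = d + (-p + q) by abel,
        cayleyCharacter_add, cayleyCharacter_add]
      ring
    simp_rw [h1]
    simp_rw [Finset.sum_comm (s := Finset.range M) (t := g.support)]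
    have h2 : ∀ d ∈ g.support, ∑ a ∈ Finset.range M, ∑ b ∈ Finset.range M,
        g d * cayleyCharacter (x a) (x b) (d - (p - q)) * c (p - q) =
        if d = p - q then (M : ℂ) ^ 2 * (g d * c (p - q)) else 0 := fun d hd => by
      obtain ⟨l1, l2⟩ := hlt d hd p hp q hq
      simp_rw [cayleyCharacter, ← Finset.sum_mul, ← Finset.mul_sum, ← Finset.sum_mul,
        hx _ l1, hx _ l2]
      by_cases h : d = p - q
      · simp only [h, sub_self, Prod.fst_zero, Prod.snd_zero, if_true]
        ring
      · rw [if_neg h]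
        have h' : d - (p - q) ≠ 0 := sub_ne_zero.mpr h
        by_cases h3 : (d - (p - q)).1 = 0
        · have h4 : (d - (p - q)).2 ≠ 0 := fun h4 => h' (Prod.ext h3 h4)
          rw [if_neg h4]
          simp
        · rw [if_neg h3]
          simp
    rw [Finset.sum_congr rfl h2, Finset.sum_ite_eq']
    split_ifs with h
    · rfl
    · rw [Finsupp.notMem_support_iff.mp h]
      simp
  have hswap : ∑ a ∈ Finset.range M, ∑ b ∈ Finset.range M,
      (g.sum fun d e => e * cayleyCharacter (x a) (x b) d) *
        ∑ p ∈ B, ∑ q ∈ B, cayleyCharacter (x a) (x b) (-p) *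
          conj (cayleyCharacter (x a) (x b) (-q)) * c (p - q) =
      ∑ p ∈ B, ∑ q ∈ B, (M : ℂ) ^ 2 * (g (p - q) * c (p - q)) := by
    simp_rw [Finset.mul_sum]
    simp_rw [Finset.sum_comm (s := Finset.range M) (t := B)]
    exact Finset.sum_congr rfl fun p hp => Finset.sum_congr rfl fun q hq => hinner p hp q hq
  rw [hswap]
  simp_rw [← Finset.mul_sum]
  rw [inv_mul_cancel_left₀ (pow_ne_zero 2 hM0)]

/-- The Fejér weight: for n ≥ |d| the count is n + 1 - |d|. -/
theorem tendsto_card_filter_sub_mem_Icc (d : ℤ) :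
    Tendsto (fun n : ℕ =>
      (((Finset.Icc (0 : ℤ) n).filter fun p => p - d ∈ Finset.Icc (0 : ℤ) n).card : ℂ) / (n + 1))
      atTop (𝓝 1) := by
  have hcard : ∀ n : ℕ, d.natAbs ≤ n →
      ((Finset.Icc (0 : ℤ) n).filter fun p => p - d ∈ Finset.Icc (0 : ℤ) n).card =
        n + 1 - d.natAbs := fun n hn => by
    have : ((Finset.Icc (0 : ℤ) n).filter fun p => p - d ∈ Finset.Icc (0 : ℤ) n) =
        Finset.Icc (max 0 d) (min n (n + d)) := by
      ext p
      simp only [Finset.mem_filter, Finset.mem_Icc]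
      omega
    rw [this, Int.card_Icc]
    omega
  have h : Tendsto (fun n : ℕ => 1 - (d.natAbs : ℂ) * (1 / ((n : ℂ) + 1))) atTop (𝓝 1) := by
    simpa using tendsto_const_nhds.sub
      ((tendsto_one_div_add_atTop_nhds_zero_nat (𝕜 := ℂ)).const_mul (d.natAbs : ℂ))
  refine h.congr' ?_
  filter_upwards [eventually_ge_atTop d.natAbs] with n hn
  have hn0 : (n : ℂ) + 1 ≠ 0 := Nat.cast_add_one_ne_zero n
  rw [hcard n hn, Nat.cast_sub (by omega)]
  field_simp
  push_cast
  ring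

theorem sum_sum_sub_eq (f : ℤ × ℤ → ℂ) {S : Finset (ℤ × ℤ)} (hf : ∀ d ∉ S, f d = 0)
    (B : Finset (ℤ × ℤ)) :
    ∑ p ∈ B, ∑ q ∈ B, f (p - q) = ∑ d ∈ S, (B.filter fun p => p - d ∈ B).card * f d := by
  have h : ∀ p ∈ B, ∑ q ∈ B, f (p - q) = ∑ d ∈ S, if p - d ∈ B then f d else 0 := fun p _ => by
    rw [← Finset.sum_filter, ← Finset.sum_filter_of_ne (p := fun q => p - q ∈ S)
      (fun q _ hq => by_contra fun h => hq (hf _ h))]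
    refine Finset.sum_nbij' (fun q => p - q) (fun d => p - d) ?_ ?_ ?_ ?_ ?_ <;> simp +contextual
  rw [Finset.sum_congr rfl h, Finset.sum_comm]
  refine Finset.sum_congr rfl fun d _ => ?_
  rw [← Finset.sum_filter, Finset.sum_const, nsmul_eq_mul]

/-- A positive definite function on `ℤ × ℤ` defines a functional on trigonometric polynomials that
is non-negative on the non-negative ones (Fejér means). -/
theorem IsPosDefOnIntProd.sum_nonneg {c : ℤ × ℤ → ℂ} (hc : IsPosDefOnIntProd c)
    {g : ℤ × ℤ →₀ ℂ} (hg : ∀ x y : ℝ, 0 ≤ g.sum fun d a => a * cayleyCharacter x y d) :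
    0 ≤ g.sum fun d a => a * c d := by
  let I' : ℕ → Finset ℤ := fun n => Finset.Icc 0 n
  let K : ℤ → ℕ → ℂ := fun d n =>
    (((Finset.Icc (0 : ℤ) n).filter fun p => p - d ∈ Finset.Icc (0 : ℤ) n).card : ℂ) / (n + 1)
  have hK : ∀ d, Tendsto (K d) atTop (𝓝 1) := tendsto_card_filter_sub_mem_Icc
  have hlim : Tendsto (fun n : ℕ => ∑ d ∈ g.support, K d.1 n * K d.2 n * (g d * c d)) atTop
      (𝓝 (g.sum fun d a => a * c d)) := by
    have : Tendsto (fun n : ℕ => ∑ d ∈ g.support, K d.1 n * K d.2 n * (g d * c d)) atTop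
        (𝓝 (∑ d ∈ g.support, 1 * 1 * (g d * c d))) :=
      tendsto_finsetSum _ fun d _ => ((hK d.1).mul (hK d.2)).mul_const _
    simpa [Finsupp.sum] using this
  refine ge_of_tendsto' hlim fun n => ?_
  have h := hc.sum_mul_nonneg hg (I' n ×ˢ I' n)
  rw [sum_sum_sub_eq (fun d => g d * c d) (S := g.support)
    (fun d hd => by simp [Finsupp.notMem_support_iff.mp hd])] at h
  have hn : (0 : ℂ) ≤ (((n : ℂ) + 1) ^ 2)⁻¹ := by
    have : (0 : ℝ) ≤ (((n : ℝ) + 1) ^ 2)⁻¹ := by positivity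
    simpa using Complex.zero_le_real.mpr this
  refine (mul_nonneg hn h).trans_eq ?_
  rw [Finset.mul_sum]
  refine Finset.sum_congr rfl fun d _ => ?_
  -- On a square box the count of pairs with difference d factors into two one-dimensional Fejér
  -- weights.
  have hfil : ((I' n ×ˢ I' n).filter fun p => p - d ∈ I' n ×ˢ I' n) =
      ((I' n).filter fun p => p - d.1 ∈ I' n) ×ˢ ((I' n).filter fun p => p - d.2 ∈ I' n) := by
    ext p
    simp only [Finset.mem_filter, Finset.mem_product, Prod.fst_sub, Prod.snd_sub]
    tauto
  have hn0 : (n : ℂ) + 1 ≠ 0 := Nat.cast_add_one_ne_zero n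
  rw [hfil, Finset.card_product]
  simp only [K, I']
  push_cast
  field_simp

end TrigonometricPositivity

/-! ### Reduction of extended monomials to trigonometric polynomials -/

section ExtendedMonomials

open Complex ComplexConjugate
open scoped ComplexOrder

/-- The four relations of an extended moment sequence, without shifts. -/
structure IsExtRelated (v : Omega → ℂ) : Prop where
  aPlus : ∀ m k l n r t, v ⟨m + 1, k, l, n, r, t⟩ + I * v ⟨m, k, l, n, r, t⟩ =
    v ⟨m, k + 1, l, n, r, t⟩
  aMinus : ∀ m k l n r t, v ⟨m + 1, k, l, n, r, t⟩ - I * v ⟨m, k, l, n, r, t⟩ =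
    v ⟨m, k, l + 1, n, r, t⟩
  bPlus : ∀ m k l n r t, v ⟨m, k, l, n + 1, r, t⟩ + I * v ⟨m, k, l, n, r, t⟩ =
    v ⟨m, k, l, n, r + 1, t⟩
  bMinus : ∀ m k l n r t, v ⟨m, k, l, n + 1, r, t⟩ - I * v ⟨m, k, l, n, r, t⟩ =
    v ⟨m, k, l, n, r, t + 1⟩

theorem isExtRelated_of_extRel {u : Omega → ℂ} (h₁ : ExtRelAPlus u) (h₂ : ExtRelAMinus u)
    (h₃ : ExtRelBPlus u) (h₄ : ExtRelBMinus u) : IsExtRelated u where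
  aPlus m k l n r t := by simpa using h₁ m k l n r t 0 0 0 0 0 0
  aMinus m k l n r t := by simpa using h₂ m k l n r t 0 0 0 0 0 0
  bPlus m k l n r t := by simpa using h₃ m k l n r t 0 0 0 0 0 0
  bMinus m k l n r t := by simpa using h₄ m k l n r t 0 0 0 0 0 0

/-- The function `x ^ m * (x + i) ^ k * (x - i) ^ l * y ^ n * (y + i) ^ r * (y - i) ^ t`. -/
noncomputable def extMonomial (x y : ℝ) (p : Omega) : ℂ :=
  ((x : ℂ) ^ p.m * ((x : ℂ) + I) ^ p.k * ((x : ℂ) - I) ^ p.l) *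
    ((y : ℂ) ^ p.n * ((y : ℂ) + I) ^ p.r * ((y : ℂ) - I) ^ p.t)

theorem isExtRelated_extMonomial (x y : ℝ) : IsExtRelated (extMonomial x y) where
  aPlus m k l n r t := by
    simp only [extMonomial, zpow_add_one₀ (ofReal_add_I_ne_zero x)]
    ring
  aMinus m k l n r t := by
    simp only [extMonomial, zpow_add_one₀ (ofReal_sub_I_ne_zero x)]
    ring
  bPlus m k l n r t := by
    simp only [extMonomial, zpow_add_one₀ (ofReal_add_I_ne_zero y)]
    ring
  bMinus m k l n r t := by
    simp only [extMonomial, zpow_add_one₀ (ofReal_sub_I_ne_zero y)]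
    ring

/-- The formal combinations of extended monomials on which all related sequences vanish. -/
noncomputable def extRelations : Submodule ℂ (Omega →₀ ℂ) :=
  ⨅ (v : Omega → ℂ) (_ : IsExtRelated v), LinearMap.ker (Finsupp.linearCombination ℂ v)

theorem mem_extRelations {f : Omega →₀ ℂ} :
    f ∈ extRelations ↔ ∀ v, IsExtRelated v → Finsupp.linearCombination ℂ v f = 0 := by
  simp [extRelations]

/-- The formal combinations of extended monomials that are, modulo the relations, homogeneous of
degree `d` in `x + i`, `x - i` and of degree `e` in `y + i`, `y - i`. -/
noncomputable def extHomogeneous (d e : ℤ) : Submodule ℂ (Omega →₀ ℂ) :=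
  extRelations ⊔ Submodule.span ℂ
    (Set.range fun j : ℤ × ℤ => Finsupp.single ⟨0, j.1, d - j.1, 0, j.2, e - j.2⟩ 1)

theorem extRelations_le_extHomogeneous (d e : ℤ) : extRelations ≤ extHomogeneous d e := le_sup_left

theorem single_mem_extHomogeneous_of_eq {d e k l r t : ℤ} (hd : k + l = d) (he : r + t = e) :
    Finsupp.single ⟨0, k, l, 0, r, t⟩ 1 ∈ extHomogeneous d e := by
  obtain rfl : l = d - k := by omega
  obtain rfl : t = e - r := by omega
  exact Submodule.mem_sup_right (Submodule.subset_span ⟨(k, r), rfl⟩)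

theorem extHomogeneous_mem_of_sub_mem {d e : ℤ} {f g : Omega →₀ ℂ} (h : f - g ∈ extRelations)
    (hg : g ∈ extHomogeneous d e) : f ∈ extHomogeneous d e := by
  have := add_mem (extRelations_le_extHomogeneous d e h) hg
  rwa [sub_add_cancel] at this

/-- Multiply by 1 = ((x+i) - (x-i))/(2i). -/
theorem extHomogeneous_le_succ_left (d e : ℤ) : extHomogeneous d e ≤ extHomogeneous (d + 1) e := by
  refine sup_le (extRelations_le_extHomogeneous _ _) (Submodule.span_le.mpr ?_)
  rintro _ ⟨⟨k, r⟩, rfl⟩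
  refine extHomogeneous_mem_of_sub_mem
    (g := (2 * I)⁻¹ • (Finsupp.single ⟨0, k + 1, d - k, 0, r, e - r⟩ 1 -
      Finsupp.single ⟨0, k, d - k + 1, 0, r, e - r⟩ 1)) ?_
    (Submodule.smul_mem _ _ (sub_mem (single_mem_extHomogeneous_of_eq (by ring) (by ring))
      (single_mem_extHomogeneous_of_eq (by ring) (by ring))))
  refine mem_extRelations.mpr fun v hv => ?_
  simp only [map_sub, map_smul, Finsupp.linearCombination_single, smul_eq_mul, ← hv.aPlus, ← hv.aMinus]
  field_simp
  ring

theorem extHomogeneous_le_succ_right (d e : ℤ) : extHomogeneous d e ≤ extHomogeneous d (e + 1) := by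
  refine sup_le (extRelations_le_extHomogeneous _ _) (Submodule.span_le.mpr ?_)
  rintro _ ⟨⟨k, r⟩, rfl⟩
  refine extHomogeneous_mem_of_sub_mem
    (g := (2 * I)⁻¹ • (Finsupp.single ⟨0, k, d - k, 0, r + 1, e - r⟩ 1 -
      Finsupp.single ⟨0, k, d - k, 0, r, e - r + 1⟩ 1)) ?_
    (Submodule.smul_mem _ _ (sub_mem (single_mem_extHomogeneous_of_eq (by ring) (by ring))
      (single_mem_extHomogeneous_of_eq (by ring) (by ring))))
  refine mem_extRelations.mpr fun v hv => ?_
  simp only [map_sub, map_smul, Finsupp.linearCombination_single, smul_eq_mul, ← hv.bPlus, ← hv.bMinus]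
  field_simp
  ring

theorem extHomogeneous_mono {d d' e e' : ℤ} (hd : d ≤ d') (he : e ≤ e') :
    extHomogeneous d e ≤ extHomogeneous d' e' :=
  (monotone_int_of_le_succ (f := fun d => extHomogeneous d e)
    (fun d => extHomogeneous_le_succ_left d e) hd).trans
    (monotone_int_of_le_succ (f := fun e => extHomogeneous d' e)
      (fun e => extHomogeneous_le_succ_right d' e) he)

/-- Each factor x or y is traded for half the sum of its two shifts by ±i, keeping the total degree.
-/
theorem single_mem_extHomogeneous (m : ℕ) (k l : ℤ) (n : ℕ) (r t : ℤ) :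
    Finsupp.single ⟨m, k, l, n, r, t⟩ 1 ∈ extHomogeneous (m + k + l) (n + r + t) := by
  induction m generalizing k l with
  | zero =>
    induction n generalizing r t with
    | zero => exact single_mem_extHomogeneous_of_eq (by simp) (by simp)
    | succ n ih =>
      have h1 := ih (r + 1) t
      have h2 := ih r (t + 1)
      rw [show (n : ℤ) + (r + 1) + t = ((n + 1 : ℕ) : ℤ) + r + t by push_cast; ring] at h1
      rw [show (n : ℤ) + r + (t + 1) = ((n + 1 : ℕ) : ℤ) + r + t by push_cast; ring] at h2
      refine extHomogeneous_mem_of_sub_mem ?_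
        (Submodule.smul_mem _ (2 : ℂ)⁻¹ (add_mem h1 h2))
      refine mem_extRelations.mpr fun v hv => ?_
      simp only [map_sub, map_smul, map_add, Finsupp.linearCombination_single,
        smul_eq_mul, ← hv.bPlus, ← hv.bMinus]
      ring
  | succ m ih =>
    have h1 := ih (k + 1) l
    have h2 := ih k (l + 1)
    rw [show (m : ℤ) + (k + 1) + l = ((m + 1 : ℕ) : ℤ) + k + l by push_cast; ring] at h1
    rw [show (m : ℤ) + k + (l + 1) = ((m + 1 : ℕ) : ℤ) + k + l by push_cast; ring] at h2
    refine extHomogeneous_mem_of_sub_mem ?_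
      (Submodule.smul_mem _ (2 : ℂ)⁻¹ (add_mem h1 h2))
    refine mem_extRelations.mpr fun v hv => ?_
    simp only [map_sub, map_smul, map_add, Finsupp.linearCombination_single,
      smul_eq_mul, ← hv.aPlus, ← hv.aMinus]
    ring

theorem exists_mem_extHomogeneous (f : Omega →₀ ℂ) :
    ∃ N : ℕ, f ∈ extHomogeneous (2 * N) (2 * N) := by
  induction f using Finsupp.induction_linear with
  | zero => exact ⟨0, zero_mem _⟩
  | add f g hf hg =>
    obtain ⟨N, hN⟩ := hf
    obtain ⟨K, hK⟩ := hg
    exact ⟨N + K, add_mem (extHomogeneous_mono (by push_cast; omega) (by push_cast; omega) hN)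
      (extHomogeneous_mono (by push_cast; omega) (by push_cast; omega) hK)⟩
  | single p a =>
    obtain ⟨m, k, l, n, r, t⟩ := p
    refine ⟨((m : ℤ) + k + l).natAbs + ((n : ℤ) + r + t).natAbs, ?_⟩
    have h := Submodule.smul_mem _ a (single_mem_extHomogeneous m k l n r t)
    rw [Finsupp.smul_single, smul_eq_mul, mul_one] at h
    exact extHomogeneous_mono (by omega) (by omega) h

/-- Every formal combination is, modulo the relations, `((x² + 1)(y² + 1)) ^ N` times a
trigonometric polynomial in the Cayley transforms of `x` and `y`. -/
theorem exists_trigonometric_representation (f : Omega →₀ ℂ) :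
    ∃ (N : ℕ) (g : ℤ × ℤ →₀ ℂ), ∀ v, IsExtRelated v → Finsupp.linearCombination ℂ v f =
      g.sum fun j a => a * v ⟨0, N + j.1, N - j.1, 0, N + j.2, N - j.2⟩ := by
  obtain ⟨N, hN⟩ := exists_mem_extHomogeneous f
  obtain ⟨κ, hκ, h, hh, rfl⟩ := Submodule.mem_sup.mp hN
  have hrange : (Set.range fun j : ℤ × ℤ =>
      (Finsupp.single (⟨0, j.1, 2 * N - j.1, 0, j.2, 2 * N - j.2⟩ : Omega) (1 : ℂ))) =
      Set.range fun j : ℤ × ℤ =>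
        Finsupp.single (⟨0, N + j.1, N - j.1, 0, N + j.2, N - j.2⟩ : Omega) (1 : ℂ) := by
    -- Recentring the exponents at N is what the even degree 2N is for: (x+i)^(N+j) (x-i)^(N-j) is
    -- (x²+1)^N times the j-th power of the Cayley transform.
    rw [← (Equiv.addLeft ((N : ℤ), (N : ℤ))).surjective.range_comp]
    congr 1
    ext1 j
    simp only [Function.comp_apply, Equiv.coe_addLeft, Prod.fst_add, Prod.snd_add]
    congr 2 <;> ring
  rw [hrange, Finsupp.mem_span_range_iff_exists_finsupp] at hh
  obtain ⟨g, rfl⟩ := hh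
  refine ⟨N, g, fun v hv => ?_⟩
  rw [map_add, mem_extRelations.mp hκ v hv, zero_add, map_finsuppSum]
  refine Finsupp.sum_congr fun j _ => ?_
  simp

theorem extMonomial_cayley (x y : ℝ) (N : ℕ) (j : ℤ × ℤ) :
    extMonomial x y ⟨0, N + j.1, N - j.1, 0, N + j.2, N - j.2⟩ =
      ((((x ^ 2 + 1) * (y ^ 2 + 1)) ^ N : ℝ) : ℂ) * cayleyCharacter x y j := by
  have h : ∀ (x : ℝ) (j : ℤ), ((x : ℂ) + I) ^ (N + j) * ((x : ℂ) - I) ^ (N - j) =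
      ((x : ℂ) ^ 2 + 1) ^ N * (((x : ℂ) + I) / ((x : ℂ) - I)) ^ j := fun x j => by
    have hx : (x : ℂ) ^ 2 + 1 = ((x : ℂ) + I) * ((x : ℂ) - I) := by
      ring_nf
      simp [add_comm]
    rw [hx, zpow_add₀ (ofReal_add_I_ne_zero x), zpow_sub₀ (ofReal_sub_I_ne_zero x), div_zpow,
      mul_pow, zpow_natCast, zpow_natCast]
    ring
  simp only [extMonomial, cayleyCharacter, pow_zero, one_mul, h]
  rw [ofReal_pow, ofReal_mul, mul_pow]
  push_cast
  ring

theorem ExtPositive.isPosDefOnIntProd {u : Omega → ℂ} (hu : ExtPositive u) (N : ℕ) :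
    IsPosDefOnIntProd fun j => u ⟨0, N + j.1, N - j.1, 0, N + j.2, N - j.2⟩ := by
  intro β
  -- Since conjugation swaps the two exponents, pairing `e p` with `e q` gives N + (p - q) and N -
  -- (p - q): the N enters exactly once in each.
  let e : ℤ × ℤ → Omega := fun p => ⟨0, N + p.1, -p.1, 0, N + p.2, -p.2⟩
  have he : Function.Injective e := fun p q h => by
    have h1 := congrArg Omega.l h
    have h2 := congrArg Omega.t h
    simp only [e, neg_inj] at h1 h2
    exact Prod.ext h1 h2
  have h : 0 ≤ (β.mapDomain e).sum fun p a => (β.mapDomain e).sum fun q b => a * conj b *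
    u ⟨p.m + q.m, p.k + q.l, p.l + q.k, p.n + q.n, p.r + q.t, p.t + q.r⟩ := hu (β.mapDomain e)
  rw [Finsupp.sum_mapDomain_index_inj he] at h
  refine h.trans_eq (Finsupp.sum_congr fun p _ => ?_)
  rw [Finsupp.sum_mapDomain_index_inj he]
  refine Finsupp.sum_congr fun q _ => ?_
  simp only [e, Prod.fst_sub, Prod.snd_sub]
  congr 3 <;> ring

/-- A positive related sequence defines a functional that is non-negative on all combinations of
extended monomials that are non-negative functions. -/
theorem ExtPositive.linearCombination_nonneg {u : Omega → ℂ} (hu : ExtPositive u)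
    (hrel : IsExtRelated u) {f : Omega →₀ ℂ}
    (hf : ∀ x y : ℝ, 0 ≤ Finsupp.linearCombination ℂ (extMonomial x y) f) :
    0 ≤ Finsupp.linearCombination ℂ u f := by
  obtain ⟨N, g, hg⟩ := exists_trigonometric_representation f
  rw [hg u hrel]
  refine (hu.isPosDefOnIntProd N).sum_nonneg fun x y => ?_
  have h := hf x y
  rw [hg _ (isExtRelated_extMonomial x y)] at h
  simp_rw [extMonomial_cayley] at h
  have hpos : (0 : ℝ) < ((x ^ 2 + 1) * (y ^ 2 + 1)) ^ N := by positivity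
  have h' := mul_nonneg (Complex.zero_le_real.mpr (inv_nonneg.mpr hpos.le)) h
  refine h'.trans_eq ?_
  rw [Finsupp.mul_sum]
  refine Finsupp.sum_congr fun j _ => ?_
  have hne : ((((x ^ 2 + 1) * (y ^ 2 + 1)) ^ N : ℝ) : ℂ) ≠ 0 := by exact_mod_cast hpos.ne'
  rw [ofReal_inv]
  field_simp

end ExtendedMonomials

/-! ### The two directions of the moment problem -/

section MomentProblem

open Complex ComplexConjugate
open scoped ComplexOrder

theorem extMonomial_mul_conj (x y : ℝ) (p q : Omega) :
    extMonomial x y ⟨p.m + q.m, p.k + q.l, p.l + q.k, p.n + q.n, p.r + q.t, p.t + q.r⟩ =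
      extMonomial x y p * conj (extMonomial x y q) := by
  simp only [extMonomial, map_mul, map_pow, map_zpow₀, map_add, map_sub, conj_ofReal, conj_I,
    sub_neg_eq_add, ← sub_eq_add_neg, zpow_add₀ (ofReal_add_I_ne_zero _),
    zpow_add₀ (ofReal_sub_I_ne_zero _), pow_add]
  ring

theorem IsExtRelated.integral {X : Type*} [MeasurableSpace X] {μ : Measure X}
    {φ : X → Omega → ℂ} (hφ : ∀ x, IsExtRelated (φ x))
    (hint : ∀ p, Integrable (fun x => φ x p) μ) : IsExtRelated fun p => ∫ x, φ x p ∂μ where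
  aPlus m k l n r t := by
    rw [← integral_const_mul, ← integral_add (hint _) ((hint _).const_mul _)]
    simp_rw [(hφ _).aPlus]
  aMinus m k l n r t := by
    rw [← integral_const_mul, ← integral_sub (hint _) ((hint _).const_mul _)]
    simp_rw [(hφ _).aMinus]
  bPlus m k l n r t := by
    rw [← integral_const_mul, ← integral_add (hint _) ((hint _).const_mul _)]
    simp_rw [(hφ _).bPlus]
  bMinus m k l n r t := by
    rw [← integral_const_mul, ← integral_sub (hint _) ((hint _).const_mul _)]
    simp_rw [(hφ _).bMinus]

theorem norm_zpow_le_pow_natAbs {z : ℂ} {b : ℝ} (h1 : 1 ≤ ‖z‖) (hb : ‖z‖ ≤ b) (k : ℤ) :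
    ‖z ^ k‖ ≤ b ^ k.natAbs := by
  rw [norm_zpow]
  calc ‖z‖ ^ k ≤ ‖z‖ ^ (k.natAbs : ℤ) := zpow_le_zpow_right₀ h1 (by omega)
    _ = ‖z‖ ^ k.natAbs := zpow_natCast _ _
    _ ≤ b ^ k.natAbs := pow_le_pow_left₀ (norm_nonneg _) hb _

/-- As 1 ≤ |x ± i| ≤ |x ± i|² = 1 + x², negative exponents may be replaced by their absolute values.
-/
theorem norm_mul_zpow_mul_zpow_le (x : ℝ) (m : ℕ) (k l : ℤ) :
    ‖(x : ℂ) ^ m * ((x : ℂ) + I) ^ k * ((x : ℂ) - I) ^ l‖ ≤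
      (1 + x ^ 2) ^ (m + k.natAbs + l.natAbs) := by
  have hx : ‖(x : ℂ)‖ ≤ 1 + x ^ 2 := by
    rw [norm_real, Real.norm_eq_abs]
    nlinarith [sq_abs x, sq_nonneg (|x| - 1), abs_nonneg x]
  have hp : ‖(x : ℂ) + I‖ ^ 2 = 1 + x ^ 2 := by
    rw [← Complex.normSq_eq_norm_sq, Complex.normSq_apply]
    simp
    ring
  have hm : ‖(x : ℂ) - I‖ ^ 2 = 1 + x ^ 2 := by
    rw [← Complex.normSq_eq_norm_sq, Complex.normSq_apply]
    simp
    ring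
  have hp1 : 1 ≤ ‖(x : ℂ) + I‖ := by nlinarith [norm_nonneg ((x : ℂ) + I), sq_nonneg x]
  have hm1 : 1 ≤ ‖(x : ℂ) - I‖ := by nlinarith [norm_nonneg ((x : ℂ) - I), sq_nonneg x]
  rw [norm_mul, norm_mul, norm_pow, pow_add, pow_add]
  have hb : 0 ≤ 1 + x ^ 2 := by positivity
  exact mul_le_mul
    (mul_le_mul (pow_le_pow_left₀ (norm_nonneg _) hx _)
      (norm_zpow_le_pow_natAbs hp1 (by nlinarith) k) (norm_nonneg _) (by positivity))
    (norm_zpow_le_pow_natAbs hm1 (by nlinarith) l) (norm_nonneg _) (by positivity)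

theorem SolvesMomentProblem.integrable_one_add_sq_pow {s : ℕ → ℕ → ℂ} {μ : Measure (ℝ × ℝ)}
    (h : SolvesMomentProblem s μ) (a b : ℕ) :
    Integrable (fun x : ℝ × ℝ => (1 + x.1 ^ 2) ^ a * (1 + x.2 ^ 2) ^ b) μ := by
  have hmon : ∀ m n : ℕ, Integrable (fun x : ℝ × ℝ => x.1 ^ m * x.2 ^ n) μ := fun m n => by
    simpa only [← ofReal_pow, ← ofReal_mul, ofReal_re, RCLike.re_to_complex] using (h m n).1.re
  have hexp : (fun x : ℝ × ℝ => (1 + x.1 ^ 2) ^ a * (1 + x.2 ^ 2) ^ b) = fun x : ℝ × ℝ =>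
      ∑ i ∈ Finset.range (a + 1), ∑ j ∈ Finset.range (b + 1),
        (x.1 ^ (2 * i) * x.2 ^ (2 * j)) * ((a.choose i : ℝ) * (b.choose j : ℝ)) := by
    funext x
    rw [add_comm 1 (x.1 ^ 2), add_comm 1 (x.2 ^ 2), add_pow, add_pow, Finset.sum_mul_sum]
    refine Finset.sum_congr rfl fun i _ => Finset.sum_congr rfl fun j _ => ?_
    simp only [one_pow, mul_one, pow_mul]
    ring
  rw [hexp]
  exact integrable_finsetSum _ fun i _ => integrable_finsetSum _ fun j _ =>
    (hmon _ _).mul_const _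

theorem continuous_extMonomial (p : Omega) :
    Continuous fun x : ℝ × ℝ => extMonomial x.1 x.2 p := by
  have h1 : ∀ k : ℤ, Continuous fun x : ℝ => ((x : ℂ) + I) ^ k := fun k =>
    (by fun_prop : Continuous fun x : ℝ => (x : ℂ) + I).zpow₀ k
      fun x => Or.inl (ofReal_add_I_ne_zero x)
  have h2 : ∀ k : ℤ, Continuous fun x : ℝ => ((x : ℂ) - I) ^ k := fun k =>
    (by fun_prop : Continuous fun x : ℝ => (x : ℂ) - I).zpow₀ k
      fun x => Or.inl (ofReal_sub_I_ne_zero x)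
  have h3 : ∀ (m : ℕ) (k l : ℤ),
      Continuous fun x : ℝ => (x : ℂ) ^ m * ((x : ℂ) + I) ^ k * ((x : ℂ) - I) ^ l :=
    fun m k l => ((by fun_prop : Continuous fun x : ℝ => (x : ℂ) ^ m).mul (h1 k)).mul (h2 l)
  exact ((h3 p.m p.k p.l).comp continuous_fst).mul ((h3 p.n p.r p.t).comp continuous_snd)

theorem SolvesMomentProblem.integrable_extMonomial {s : ℕ → ℕ → ℂ} {μ : Measure (ℝ × ℝ)}
    (h : SolvesMomentProblem s μ) (p : Omega) :
    Integrable (fun x : ℝ × ℝ => extMonomial x.1 x.2 p) μ := by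
  refine (h.integrable_one_add_sq_pow (p.m + p.k.natAbs + p.l.natAbs)
    (p.n + p.r.natAbs + p.t.natAbs)).mono' (continuous_extMonomial p).aestronglyMeasurable
    (Filter.Eventually.of_forall fun x => ?_)
  rw [extMonomial, norm_mul]
  exact mul_le_mul (norm_mul_zpow_mul_zpow_le _ _ _ _) (norm_mul_zpow_mul_zpow_le _ _ _ _)
    (norm_nonneg _) (by positivity)

theorem SolvesMomentProblem.extPositive {s : ℕ → ℕ → ℂ} {μ : Measure (ℝ × ℝ)}
    (h : SolvesMomentProblem s μ) :
    ExtPositive fun p => ∫ x : ℝ × ℝ, extMonomial x.1 x.2 p ∂μ := by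
  intro α
  have hint := h.integrable_extMonomial
  have hnonneg : 0 ≤ ∫ x : ℝ × ℝ, ‖∑ p ∈ α.support, α p * extMonomial x.1 x.2 p‖ ^ 2 ∂μ :=
    integral_nonneg fun x => by positivity
  refine (Complex.zero_le_real.mpr hnonneg).trans_eq ?_
  rw [← integral_complex_ofReal]
  have hexp : ∀ x : ℝ × ℝ,
      ((‖∑ p ∈ α.support, α p * extMonomial x.1 x.2 p‖ ^ 2 : ℝ) : ℂ) =
      ∑ p ∈ α.support, ∑ q ∈ α.support, α p * conj (α q) * extMonomial x.1 x.2
        ⟨p.m + q.m, p.k + q.l, p.l + q.k, p.n + q.n, p.r + q.t, p.t + q.r⟩ := fun x => by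
    rw [ofReal_pow, ← Complex.mul_conj', map_sum, Finset.sum_mul_sum]
    refine Finset.sum_congr rfl fun p _ => Finset.sum_congr rfl fun q _ => ?_
    rw [extMonomial_mul_conj, map_mul]
    ring
  have e : (∫ x : ℝ × ℝ, ((‖∑ p ∈ α.support, α p * extMonomial x.1 x.2 p‖ ^ 2 : ℝ) : ℂ) ∂μ) =
      ∫ x : ℝ × ℝ, ∑ p ∈ α.support, ∑ q ∈ α.support, α p * conj (α q) * extMonomial x.1 x.2
        ⟨p.m + q.m, p.k + q.l, p.l + q.k, p.n + q.n, p.r + q.t, p.t + q.r⟩ ∂μ :=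
    integral_congr_ae (Filter.Eventually.of_forall hexp)
  refine e.trans ?_
  rw [integral_finsetSum _ fun p _ => integrable_finsetSum _ fun q _ => (hint _).const_mul _]
  refine Finset.sum_congr rfl fun p _ => ?_
  rw [integral_finsetSum _ fun q _ => (hint _).const_mul _]
  exact Finset.sum_congr rfl fun q _ => integral_const_mul _ _

theorem IsExtRelated.extRelAPlus {u : Omega → ℂ} (h : IsExtRelated u) : ExtRelAPlus u :=
  fun m k l n r t a b c d e f => by
    rw [add_right_comm m, add_right_comm k]
    exact h.aPlus _ _ _ _ _ _

theorem IsExtRelated.extRelAMinus {u : Omega → ℂ} (h : IsExtRelated u) : ExtRelAMinus u :=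
  fun m k l n r t a b c d e f => by
    rw [add_right_comm m, add_right_comm l]
    exact h.aMinus _ _ _ _ _ _

theorem IsExtRelated.extRelBPlus {u : Omega → ℂ} (h : IsExtRelated u) : ExtRelBPlus u :=
  fun m k l n r t a b c d e f => by
    rw [add_right_comm n, add_right_comm r]
    exact h.bPlus _ _ _ _ _ _

theorem IsExtRelated.extRelBMinus {u : Omega → ℂ} (h : IsExtRelated u) : ExtRelBMinus u :=
  fun m k l n r t a b c d e f => by
    rw [add_right_comm n, add_right_comm t]
    exact h.bMinus _ _ _ _ _ _

/-- The linear functional on real polynomials in two variables with prescribed values on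
monomials. -/
noncomputable def monomialFunctional {V : Type*} [AddCommGroup V] [Module ℝ V] (v : ℕ → ℕ → V) :
    MvPolynomial (Fin 2) ℝ →ₗ[ℝ] V :=
  (MvPolynomial.basisMonomials (Fin 2) ℝ).constr ℝ fun m => v (m 0) (m 1)

theorem monomialFunctional_monomial {V : Type*} [AddCommGroup V] [Module ℝ V] (v : ℕ → ℕ → V)
    (m : Fin 2 →₀ ℕ) : monomialFunctional v (MvPolynomial.monomial m 1) = v (m 0) (m 1) := by
  rw [← congrFun (MvPolynomial.coe_basisMonomials (σ := Fin 2) (R := ℝ)) m]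
  exact (MvPolynomial.basisMonomials (Fin 2) ℝ).constr_basis ℝ _ m

/-- Lifts a polynomial to a formal combination, so that `u` and point evaluations act on the same
object. -/
theorem linearCombination_monomialFunctional (v : Omega → ℂ) (q : MvPolynomial (Fin 2) ℝ) :
    Finsupp.linearCombination ℂ v (monomialFunctional
      (fun m n => Finsupp.single (⟨m, 0, 0, n, 0, 0⟩ : Omega) (1 : ℂ)) q) =
    monomialFunctional (fun m n => v ⟨m, 0, 0, n, 0, 0⟩) q := by
  have : ((Finsupp.linearCombination ℂ v).restrictScalars ℝ) ∘ₗ (monomialFunctional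
      (fun m n => Finsupp.single (⟨m, 0, 0, n, 0, 0⟩ : Omega) (1 : ℂ))) =
      monomialFunctional (fun m n => v ⟨m, 0, 0, n, 0, 0⟩) := by
    refine (MvPolynomial.basisMonomials (Fin 2) ℝ).ext fun m => ?_
    simp [monomialFunctional_monomial]
  exact LinearMap.congr_fun this q

theorem monomialFunctional_pow_mul_pow (x : Fin 2 → ℝ) (q : MvPolynomial (Fin 2) ℝ) :
    monomialFunctional (fun m n => (x 0 : ℂ) ^ m * (x 1 : ℂ) ^ n) q =
      ((MvPolynomial.eval x q : ℝ) : ℂ) := by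
  have : monomialFunctional (fun m n => (x 0 : ℂ) ^ m * (x 1 : ℂ) ^ n) =
      Complex.ofRealCLM.toLinearMap ∘ₗ (MvPolynomial.aeval (R := ℝ) x).toLinearMap := by
    refine (MvPolynomial.basisMonomials (Fin 2) ℝ).ext fun m => ?_
    simp [monomialFunctional_monomial, MvPolynomial.eval_monomial, Finsupp.prod_fintype]
  rw [this]
  simp [MvPolynomial.aeval_eq_eval]

theorem ExtPositive.monomialFunctional_nonneg {u : Omega → ℂ} (hu : ExtPositive u)
    (hrel : IsExtRelated u) {q : MvPolynomial (Fin 2) ℝ}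
    (hq : ∀ x, 0 ≤ MvPolynomial.eval x q) :
    0 ≤ monomialFunctional (fun m n => u ⟨m, 0, 0, n, 0, 0⟩) q := by
  rw [← linearCombination_monomialFunctional]
  refine hu.linearCombination_nonneg hrel fun x y => ?_
  rw [linearCombination_monomialFunctional]
  have h := monomialFunctional_pow_mul_pow ![x, y] q
  simp only [Matrix.cons_val_zero, Matrix.cons_val_one] at h
  simp only [extMonomial, zpow_zero, mul_one]
  rw [h]
  exact Complex.zero_le_real.mpr (hq _)

theorem exists_solvesMomentProblem_of_nonneg {s : ℕ → ℕ → ℂ}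
    (h : ∀ q : MvPolynomial (Fin 2) ℝ, (∀ x, 0 ≤ MvPolynomial.eval x q) →
      0 ≤ monomialFunctional s q) : ∃ μ : Measure (ℝ × ℝ), SolvesMomentProblem s μ := by
  obtain ⟨μ, hμ⟩ := exists_measure_of_nonneg_of_eval_nonneg
    (Complex.reCLM.toLinearMap ∘ₗ monomialFunctional s)
    (fun q hq => (Complex.nonneg_iff.mp (h q hq)).1)
  -- Differences of non-negative polynomials exhaust all polynomials, so passing to the real part
  -- loses nothing.
  have him : ∀ q, (monomialFunctional s q).im = 0 := fun q => by
    obtain ⟨a, b, ha, hb, rfl⟩ := exists_sub_eq_of_eval_nonneg q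
    rw [map_sub, Complex.sub_im, ← (Complex.nonneg_iff.mp (h a ha)).2,
      ← (Complex.nonneg_iff.mp (h b hb)).2, sub_zero]
  refine ⟨μ.map (MeasurableEquiv.finTwoArrow (α := ℝ)), fun m n => ?_⟩
  let d : Fin 2 →₀ ℕ := Finsupp.equivFunOnFinite.symm ![m, n]
  have heval : ∀ x : Fin 2 → ℝ, MvPolynomial.eval x (MvPolynomial.monomial d 1) =
      x 0 ^ m * x 1 ^ n := fun x => by
    simp [MvPolynomial.eval_monomial, Finsupp.prod_fintype, d]
  obtain ⟨hi, he⟩ := hμ (MvPolynomial.monomial d 1)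
  simp_rw [heval] at hi he
  have hs : monomialFunctional s (MvPolynomial.monomial d 1) = s m n := by
    rw [monomialFunctional_monomial]
    simp [d]
  have hre : ((∫ x, x 0 ^ m * x 1 ^ n ∂μ : ℝ) : ℂ) = s m n := by
    rw [he, ← hs]
    exact Complex.ext (by simp) (by simp [him])
  rw [integrable_map_equiv, integral_map_equiv, ← hre, ← integral_complex_ofReal]
  refine ⟨?_, ?_⟩
  · refine hi.ofReal.congr (Filter.Eventually.of_forall fun x => ?_)
    simp [MeasurableEquiv.finTwoArrow]
  · refine integral_congr_ae (Filter.Eventually.of_forall fun x => ?_)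
    simp [MeasurableEquiv.finTwoArrow]

end MomentProblem

theorem theorem3 (s : ℕ → ℕ → ℂ) :
    (∃ μ : Measure (ℝ × ℝ), SolvesMomentProblem s μ) ↔
      ∃ u : Omega → ℂ,
        ExtPositive u ∧ ExtRelAPlus u ∧ ExtRelAMinus u ∧ ExtRelBPlus u ∧ ExtRelBMinus u ∧
          ∀ m n : ℕ, u ⟨m, 0, 0, n, 0, 0⟩ = s m n := by
  constructor
  · rintro ⟨μ, hμ⟩
    have hrel : IsExtRelated fun p => ∫ x : ℝ × ℝ, extMonomial x.1 x.2 p ∂μ :=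
      IsExtRelated.integral (fun x => isExtRelated_extMonomial x.1 x.2) hμ.integrable_extMonomial
    refine ⟨_, hμ.extPositive, hrel.extRelAPlus, hrel.extRelAMinus, hrel.extRelBPlus,
      hrel.extRelBMinus, fun m n => ?_⟩
    simpa only [extMonomial, zpow_zero, mul_one] using (hμ m n).2
  · rintro ⟨u, hu, h₁, h₂, h₃, h₄, hs⟩
    refine exists_solvesMomentProblem_of_nonneg fun q hq => ?_
    obtain rfl : (fun m n => u ⟨m, 0, 0, n, 0, 0⟩) = s := funext₂ hs
    exact hu.monomialFunctional_nonneg (isExtRelated_of_extRel h₁ h₂ h₃ h₄) hq
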